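/- **Notation.** For $\sigma=(\sigma_1,\dots,\sigma_D)$ with $\sigma_i\ge 0$ and mean $\bar\sigma=\frac1D\sum_i\sigma_i$, put $\mathrm{CV}^2(\sigma)=\frac1D\sum_i(\sigma_i-\bar\sigma)^2/\bar\sigma^2$. In the per-coordinate model let $Z_1,\dots,Z_D$ be independent with $Z_i\sim\mathcal N(0,\sigma_i^2)$, let $\alpha=\sqrt{2/\pi}\,\bar\sigma$ be the magnitude threshold, and let $\rho_1(\sigma)$ and $\rho_2(\sigma)$ be the Pearson correlations of $\sum_i Z_i$ with the 1-bit score $\sum_i\operatorname{sign}(Z_i)$ and with the 2-bit score $\sum_i(1+\mathbf 1[|Z_i|>\alpha])\operatorname{sign}(Z_i)$, respectively. Write $\mathbf 1_D$ for the all-ones vector of $\mathbb R^D$. The 2-bit advantage is decomposed as $$\Delta\rho(\sigma):=\rho_2(\sigma)-\rho_1(\sigma)=\Delta_0+\Delta_{\mathrm{het}}(\sigma),\qquad \Delta_0:=\rho_2(\bar\sigma\mathbf 1_D)-\rho_1(\bar\sigma\mathbf 1_D).$$ **Corollary (rotation harms heterogeneity-aware BQ).** The isotropic gain $\Delta_0$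 is a strictly positive universal constant: it has the same value for all $D\ge1$ and all $\sigma\in\mathbb R_{\ge0}^D$ with $\bar\sigma>0$. Let $(\Sigma_k)_k$ be any sequence of real symmetric positive semidefinite matrices, $\Sigma_k$ of size $D_k\times D_k$, satisfying the effective-rank condition $$\frac{\operatorname{tr}(\Sigma_k)}{\|\Sigma_k\|_{\mathrm{op}}}\longrightarrow\infty ,$$ let $Q_k$ be a Haar-random orthogonal $D_k\times D_k$ matrix with rows $q_1^\top,\dots,q_{D_k}^\top$, and let $\tilde\sigma^{(k)}_i=\sqrt{q_i^\top\Sigma_k q_i}$ be the coordinate standard deviations after rotation. Then, as $k\to\infty$, in probability, $$\mathrm{CV}^2(\tilde\sigma^{(k)})\to0,\qquad \Delta_{\mathrm{het}}(\tilde\sigma^{(k)})\to0,\qquad \Delta\rho(\tilde\sigma^{(k)})\to\Delta_0>0 .$$ That is, rotation eliminates the heterogeneity-dependent part of the 2-bit advantage, while the isotropic gain survives. -/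

import Mathlib

open MeasureTheory ProbabilityTheory Filter Topology

noncomputable section

namespace BQ

/-! ### Haar measure on the orthogonal group -/

/-- The real orthogonal group `O(D)`, with the topology induced from `D × D` matrices. -/
abbrev Orth (D : ℕ) : Type := ↥(Matrix.orthogonalGroup (Fin D) ℝ)

instance instCompactSpaceOrth (D : ℕ) : CompactSpace (Orth D) := by
  refine isCompact_iff_compactSpace.mp
    (?_ : IsCompact (Matrix.orthogonalGroup (Fin D) ℝ : Set (Matrix (Fin D) (Fin D) ℝ)))
  have hbox : IsCompact {A : Matrix (Fin D) (Fin D) ℝ | ∀ i j, A i j ∈ Set.Icc (-1 : ℝ) 1} := by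
    have h := isCompact_univ_pi (X := fun _ : Fin D => Fin D → ℝ)
      (s := fun _ => Set.univ.pi fun _ => Set.Icc (-1 : ℝ) 1)
      (fun _ => isCompact_univ_pi fun _ => isCompact_Icc)
    have heq : {A : Matrix (Fin D) (Fin D) ℝ | ∀ i j, A i j ∈ Set.Icc (-1 : ℝ) 1}
        = Set.univ.pi fun _ : Fin D => Set.univ.pi fun _ : Fin D => Set.Icc (-1 : ℝ) 1 :=
      Set.ext fun A => ⟨fun hA i _ j _ => hA i j, fun hA i j => hA i trivial j trivial⟩
    rw [heq]
    exact h
  refine hbox.of_isClosed_subset ?_ ?_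
  · have hc : Continuous fun A : Matrix (Fin D) (Fin D) ℝ => A * star A := by fun_prop
    have heq : (Matrix.orthogonalGroup (Fin D) ℝ : Set (Matrix (Fin D) (Fin D) ℝ))
        = (fun A : Matrix (Fin D) (Fin D) ℝ => A * star A) ⁻¹' {1} := by
      ext A
      exact Matrix.mem_unitaryGroup_iff
    rw [heq]
    exact isClosed_singleton.preimage hc
  · intro A hA i j
    have h := entry_norm_bound_of_unitary (𝕜 := ℝ) hA i j
    rw [Real.norm_eq_abs] at h
    exact abs_le.mp h

instance instMeasurableSpaceOrth (D : ℕ) : MeasurableSpace (Orth D) := borel _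

instance instBorelSpaceOrth (D : ℕ) : BorelSpace (Orth D) := ⟨rfl⟩

/-- The law of a Haar-random orthogonal matrix: the Haar measure of `O(D)` of total mass `1`. -/
def haarOrth (D : ℕ) : Measure (Orth D) := Measure.haarMeasure ⊤

instance instIsProbabilityMeasureHaarOrth (D : ℕ) : IsProbabilityMeasure (haarOrth D) :=
  ⟨by
    have h := Measure.haarMeasure_self (G := Orth D) (K₀ := ⊤)
    rwa [TopologicalSpace.PositiveCompacts.coe_top] at h⟩

/-! ### Covariances, effective rank, rotated standard deviations -/

/-- The effective rank `tr S / ‖S‖_op`; the norm is the operator norm on Euclidean space. -/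
def effRank {D : ℕ} (S : Matrix (Fin D) (Fin D) ℝ) : ℝ :=
  S.trace / ‖Matrix.toEuclideanCLM (n := Fin D) (𝕜 := ℝ) S‖

/-- The coordinate standard deviations after rotation by `Q`: the square roots of the diagonal
entries `qᵢᵀ S qᵢ` of `Q S Qᵀ`, where `qᵢᵀ` is the `i`-th row of `Q`. -/
def rotatedStd {D : ℕ} (S : Matrix (Fin D) (Fin D) ℝ) (Q : Orth D) (i : Fin D) : ℝ :=
  Real.sqrt ((Q.1 * S * Q.1.transpose) i i)

/-- The mean of the entries of `σ`. -/
def mean {D : ℕ} (σ : Fin D → ℝ) : ℝ := (∑ i, σ i) / D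

/-- The squared coefficient of variation of the entries of `σ`. -/
def cvSq {D : ℕ} (σ : Fin D → ℝ) : ℝ :=
  ((∑ i, (σ i - mean σ) ^ 2) / D) / mean σ ^ 2

/-! ### The per-coordinate model -/

/-- Independent centred Gaussian coordinates with standard deviations `σ i`. -/
def model {D : ℕ} (σ : Fin D → ℝ) : Measure (Fin D → ℝ) :=
  Measure.pi fun i => gaussianReal 0 (Real.toNNReal (σ i ^ 2))

/-- The magnitude threshold: for `σ ≥ 0` this is `(1/D) ∑ i, E|z i|` in the model. -/
def threshold {D : ℕ} (σ : Fin D → ℝ) : ℝ := Real.sqrt (2 / Real.pi) * mean σ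

open Classical in
/-- The magnitude bit with threshold `α`. -/
def magBit (α t : ℝ) : ℝ := if α < |t| then 1 else 0

/-- One-bit score with uniform weights. -/
def score1 {D : ℕ} (z : Fin D → ℝ) : ℝ := ∑ i, Real.sign (z i)

/-- Two-bit score with uniform weights and magnitude threshold `α`. -/
def score2 {D : ℕ} (α : ℝ) (z : Fin D → ℝ) : ℝ :=
  ∑ i, (1 + magBit α (z i)) * Real.sign (z i)

/-- The unquantized score with uniform weights. -/
def score {D : ℕ} (z : Fin D → ℝ) : ℝ := ∑ i, z i

/-- Pearson correlation. -/
def corr {Ω : Type*} [MeasurableSpace Ω] (X Y : Ω → ℝ) (μ : Measure Ω) : ℝ :=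
  covariance X Y μ / Real.sqrt (variance X μ * variance Y μ)

/-- Fidelity of the one-bit score. -/
def rho1 {D : ℕ} (σ : Fin D → ℝ) : ℝ := corr score1 score (model σ)

/-- Fidelity of the two-bit score. -/
def rho2 {D : ℕ} (σ : Fin D → ℝ) : ℝ := corr (score2 (threshold σ)) score (model σ)

/-- The two-bit advantage `Δρ(σ)`. -/
def advantage {D : ℕ} (σ : Fin D → ℝ) : ℝ := rho2 σ - rho1 σ

/-- The isotropic gain: the two-bit advantage when every standard deviation is replaced by
the mean one. -/
def isoGain {D : ℕ} (σ : Fin D → ℝ) : ℝ :=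
  rho2 (fun _ : Fin D => mean σ) - rho1 (fun _ : Fin D => mean σ)

/-- The heterogeneity term `Δ_het(σ) = Δρ(σ) - Δ₀`. -/
def hetGain {D : ℕ} (σ : Fin D → ℝ) : ℝ := advantage σ - isoGain σ

/-- Convergence to `0` in probability of real random variables `X k` on `O(d k)`. -/
def TendstoZeroInProb {d : ℕ → ℕ} (X : ∀ k, Orth (d k) → ℝ) : Prop :=
  ∀ ε : ℝ, 0 < ε → Tendsto (fun k => haarOrth (d k) {Q | ε ≤ |X k Q|}) atTop (𝓝 0)

end BQ

end

/-! By independence and oddness, the correlation of a coordinate score with the plain sum is a ratio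
built from averages over the coordinates of three functions of `u = σ i / mean σ`: `crossMoment`,
`sqMoment` and `u ^ 2` (`corr_sum_score`). The threshold scales with the mean, so these functions do
not depend on `σ` or on the dimension. They are continuous at `1` and grow at most quadratically,
hence each average differs from the value at `1` by at most `ε + K * cvSq σ` (`tendsto_normAvg`). So
the advantage tends to its isotropic value as `cvSq` tends to `0`, uniformly in the dimension
(`exists_abs_advantage_sub_lt`), and that value is positive by an explicit Gaussian computation
(`isoCorr_sign_lt_isoCorr_twoBit`).

Rotation makes `cvSq` small by a second-moment bound. Let `A = Q S Qᵀ`. Haar invariance under a 45°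
change of two coordinates ties the differences of diagonal entries of `A` to its off-diagonal
entries (`integral_sq_diag_sub`). Summing over pairs bounds the spread of the diagonal by `tr (S Sᵀ)
≤ ‖S‖ tr S`, so its expected relative value is at most `2 / effRank S` (`integral_diagDev_le`).
Markov's inequality and a passage to square roots (`mean_sqrt_pos_and_cvSq_le`) finish the argument.
-/

namespace BQ

/-! ### Second moments of a Haar-rotated matrix -/

section HaarMoments

open Matrix

/-- The rows of `mixMatrix`. -/
noncomputable def mixRow {D : ℕ} (i j a : Fin D) : Fin D → ℝ :=
  if a = i then Real.sqrt (1 / 2) • (Pi.single i 1 + Pi.single j 1)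
  else if a = j then Real.sqrt (1 / 2) • (Pi.single i 1 - Pi.single j 1)
  else Pi.single a 1

/-- The matrix that replaces the basis vectors `eᵢ, eⱼ` by `(eᵢ + eⱼ) / √2, (eᵢ - eⱼ) / √2`. -/
noncomputable def mixMatrix {D : ℕ} (i j : Fin D) : Matrix (Fin D) (Fin D) ℝ :=
  Matrix.of (mixRow i j)

lemma mixMatrix_mem {D : ℕ} {i j : Fin D} (hij : i ≠ j) :
    mixMatrix i j ∈ Matrix.orthogonalGroup (Fin D) ℝ := by
  rw [Matrix.mem_orthogonalGroup_iff]
  have h2 : Real.sqrt (1 / 2) * Real.sqrt (1 / 2) = 1 / 2 := Real.mul_self_sqrt (by norm_num)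
  have hdot : ∀ a b, (mixMatrix i j * (mixMatrix i j)ᵀ) a b =
      mixRow i j a ⬝ᵥ mixRow i j b := fun a b => rfl
  ext a b
  rw [hdot, Matrix.one_apply]
  unfold mixRow
  split_ifs <;> simp_all [dotProduct_smul] <;> grind

/-- The entry is `(eᵢ + eⱼ)ᵀ A (eᵢ - eⱼ) / 2`, whose cross terms cancel by symmetry. -/
lemma mixMatrix_conj_apply {D : ℕ} {i j : Fin D} (hij : i ≠ j) (A : Matrix (Fin D) (Fin D) ℝ)
    (hA : A i j = A j i) :
    (mixMatrix i j * A * (mixMatrix i j)ᵀ) i j = (A i i - A j j) / 2 := by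
  have h2 : Real.sqrt (1 / 2) * Real.sqrt (1 / 2) = 1 / 2 := Real.mul_self_sqrt (by norm_num)
  have hdot : (mixMatrix i j * A * (mixMatrix i j)ᵀ) i j =
      (mixRow i j i ᵥ* A) ⬝ᵥ mixRow i j j := rfl
  rw [hdot, ← dotProduct_mulVec]
  simp only [mixRow, hij.symm, if_true, if_false, smul_dotProduct, mulVec_smul, dotProduct_smul,
    mulVec_sub, add_dotProduct, dotProduct_sub, mulVec_single_one, single_one_dotProduct, smul_eq_mul,
    col_apply]
  linear_combination (A i i - A j j) * h2 + √(1 / 2) * √(1 / 2) * (hA.symm)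

lemma continuous_conj_apply {D : ℕ} (S : Matrix (Fin D) (Fin D) ℝ) (i j : Fin D) :
    Continuous fun Q : Orth D => (Q.1 * S * Q.1ᵀ) i j := by
  have : Continuous fun Q : Orth D => Q.1 * S * Q.1ᵀ := by fun_prop
  exact this.matrix_elem i j

lemma integrable_haarOrth {D : ℕ} {f : Orth D → ℝ} (hf : Continuous f) :
    Integrable f (haarOrth D) := by
  exact hf.integrable_of_hasCompactSupport (HasCompactSupport.of_compactSpace f)

instance (D : ℕ) : (haarOrth D).IsMulLeftInvariant := by unfold haarOrth; infer_instance

lemma transpose_mul_self_orth {D : ℕ} (Q : Orth D) : Q.1ᵀ * Q.1 = 1 :=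
  (Matrix.mem_orthogonalGroup_iff' (Fin D) ℝ).1 Q.2

lemma sum_diag_conj {D : ℕ} (S : Matrix (Fin D) (Fin D) ℝ) (Q : Orth D) :
    ∑ i, (Q.1 * S * Q.1ᵀ) i i = S.trace := by
  change (Q.1 * S * Q.1ᵀ).trace = _
  rw [Matrix.trace_mul_comm, ← Matrix.mul_assoc, transpose_mul_self_orth, Matrix.one_mul]

/-- Orthogonal invariance of the Frobenius norm. -/
lemma sum_sq_conj {D : ℕ} (S : Matrix (Fin D) (Fin D) ℝ) (Q : Orth D) :
    ∑ i, ∑ j, (Q.1 * S * Q.1ᵀ) i j ^ 2 = (S * Sᵀ).trace := by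
  have h : ∑ i, ∑ j, (Q.1 * S * Q.1ᵀ) i j ^ 2
      = ((Q.1 * S * Q.1ᵀ) * (Q.1 * S * Q.1ᵀ)ᵀ).trace := by
    simp only [Matrix.trace, Matrix.diag, Matrix.mul_apply (M := Q.1 * S * Q.1ᵀ),
      Matrix.transpose_apply (Q.1 * S * Q.1ᵀ), sq]
  have h' : (Q.1 * S * Q.1ᵀ) * (Q.1 * S * Q.1ᵀ)ᵀ = Q.1 * (S * Sᵀ) * Q.1ᵀ := by
    simp only [Matrix.transpose_mul, Matrix.transpose_transpose, Matrix.mul_assoc]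
    rw [← Matrix.mul_assoc Q.1ᵀ Q.1, transpose_mul_self_orth, Matrix.one_mul]
  rw [h, h', Matrix.trace_mul_comm, ← Matrix.mul_assoc, transpose_mul_self_orth, Matrix.one_mul]

/-- Second moments of a Haar-rotated symmetric matrix: an off-diagonal entry against the
difference of the diagonal ones. -/
lemma integral_sq_diag_sub {D : ℕ} (S : Matrix (Fin D) (Fin D) ℝ) (hS : S.IsSymm) (i j : Fin D) :
    ∫ Q : Orth D, ((Q.1 * S * Q.1ᵀ) i i - (Q.1 * S * Q.1ᵀ) j j) ^ 2 ∂haarOrth D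
      ≤ 4 * ∫ Q : Orth D, (Q.1 * S * Q.1ᵀ) i j ^ 2 ∂haarOrth D := by
  by_cases hij : i = j
  · subst hij
    simp only [sub_self]
    have : 0 ≤ ∫ Q : Orth D, (Q.1 * S * Q.1ᵀ) i i ^ 2 ∂haarOrth D :=
      integral_nonneg fun Q => sq_nonneg _
    simpa using this
  let G : Orth D := ⟨mixMatrix i j, mixMatrix_mem hij⟩
  -- Replacing `Q` by `G * Q` on the right turns the off-diagonal entry into half the diagonal
  -- difference; for `i ≠ j` equality holds.
  rw [← integral_mul_left_eq_self (μ := haarOrth D)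
    (fun Q : Orth D => (Q.1 * S * Q.1ᵀ) i j ^ 2) G, ← integral_const_mul]
  refine le_of_eq (integral_congr_ae (.of_forall fun Q => ?_))
  have h1 : (G * Q).1 * S * (G * Q).1ᵀ = mixMatrix i j * (Q.1 * S * Q.1ᵀ) * (mixMatrix i j)ᵀ := by
    simp [G, Matrix.transpose_mul, Matrix.mul_assoc]
  have h2 : (Q.1 * S * Q.1ᵀ).IsSymm := by
    rw [Matrix.IsSymm, Matrix.transpose_mul, Matrix.transpose_mul, Matrix.transpose_transpose,
      hS.eq, Matrix.mul_assoc]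
  simp only [h1]
  rw [mixMatrix_conj_apply hij _ (h2.apply j i)]
  ring

lemma sum_sum_sq_sub {D : ℕ} (x : Fin D → ℝ) :
    ∑ i, ∑ j, (x i - x j) ^ 2 = 2 * D * ∑ i, (x i - (∑ i, x i) / D) ^ 2 := by
  rcases D.eq_zero_or_pos with rfl | hD
  · simp
  have hD' : (D : ℝ) ≠ 0 := by positivity
  simp only [sub_sq, Finset.sum_add_distrib, Finset.sum_sub_distrib, ← Finset.sum_mul,
    ← Finset.mul_sum, Finset.sum_const, Finset.card_univ, Fintype.card_fin, nsmul_eq_mul]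
  field_simp
  ring

/-- Sum `integral_sq_diag_sub` over all pairs: the left side becomes `2 * D` times the spread about
the mean, the right side four times the rotation-invariant Frobenius norm squared. -/
lemma integral_sum_sq_diag_sub_le {D : ℕ} (S : Matrix (Fin D) (Fin D) ℝ) (hS : S.IsSymm) :
    D * ∫ Q : Orth D, ∑ i, ((Q.1 * S * Q.1ᵀ) i i - S.trace / D) ^ 2 ∂haarOrth D
      ≤ 2 * (S * Sᵀ).trace := by
  have hc := continuous_conj_apply S
  have e1 : ∫ Q : Orth D, ∑ i, ∑ j, ((Q.1 * S * Q.1ᵀ) i i - (Q.1 * S * Q.1ᵀ) j j) ^ 2 ∂haarOrth D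
      = 2 * (D * ∫ Q : Orth D, ∑ i, ((Q.1 * S * Q.1ᵀ) i i - S.trace / D) ^ 2 ∂haarOrth D) := by
    rw [← mul_assoc, ← integral_const_mul]
    refine integral_congr_ae (.of_forall fun Q => ?_)
    simp only
    rw [sum_sum_sq_sub fun i => (Q.1 * S * Q.1ᵀ) i i, sum_diag_conj]
  have e2 : ∫ Q : Orth D, ∑ i, ∑ j, (Q.1 * S * Q.1ᵀ) i j ^ 2 ∂haarOrth D = (S * Sᵀ).trace := by
    simp_rw [sum_sq_conj]
    simp
  have e3 : ∫ Q : Orth D, ∑ i, ∑ j, ((Q.1 * S * Q.1ᵀ) i i - (Q.1 * S * Q.1ᵀ) j j) ^ 2 ∂haarOrth D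
      ≤ 4 * ∫ Q : Orth D, ∑ i, ∑ j, (Q.1 * S * Q.1ᵀ) i j ^ 2 ∂haarOrth D := by
    rw [integral_finsetSum _ fun i _ => integrable_haarOrth (by fun_prop),
      integral_finsetSum _ fun i _ => integrable_haarOrth (by fun_prop), Finset.mul_sum]
    refine Finset.sum_le_sum fun i _ => ?_
    rw [integral_finsetSum _ fun j _ => integrable_haarOrth (by fun_prop),
      integral_finsetSum _ fun j _ => integrable_haarOrth (by fun_prop), Finset.mul_sum]
    exact Finset.sum_le_sum fun j _ => integral_sq_diag_sub S hS i j
  rw [e1, e2] at e3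
  linarith

lemma dotProduct_mulVec_le {D : ℕ} (S : Matrix (Fin D) (Fin D) ℝ) (v : Fin D → ℝ) :
    v ⬝ᵥ S *ᵥ v ≤ ‖Matrix.toEuclideanCLM (n := Fin D) (𝕜 := ℝ) S‖ * (v ⬝ᵥ v) := by
  have h := real_inner_le_norm (WithLp.toLp 2 v) (Matrix.toEuclideanCLM (𝕜 := ℝ) S (WithLp.toLp 2 v))
  rw [Matrix.inner_toEuclideanCLM] at h
  have h2 := ContinuousLinearMap.le_opNorm (Matrix.toEuclideanCLM (𝕜 := ℝ) S) (WithLp.toLp 2 v)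
  have h3 : ‖WithLp.toLp 2 v‖ * ‖WithLp.toLp 2 v‖ = v ⬝ᵥ v := by
    rw [← real_inner_self_eq_norm_mul_norm, EuclideanSpace.inner_toLp_toLp]; simp
  rw [← h3]
  calc _ ≤ _ := h
    _ ≤ _ := mul_le_mul_of_nonneg_left h2 (norm_nonneg _)
    _ = _ := by ring

/-- With `S = Bᵀ B`, both traces are sums over the rows of `B`, and the quadratic form of `S` is
compared with the norm row by row. -/
lemma trace_mul_transpose_le {D : ℕ} {S : Matrix (Fin D) (Fin D) ℝ} (hS : S.PosSemidef) :
    (S * Sᵀ).trace ≤ ‖Matrix.toEuclideanCLM (n := Fin D) (𝕜 := ℝ) S‖ * S.trace := by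
  obtain ⟨B, hB⟩ : ∃ B : Matrix (Fin D) (Fin D) ℝ, S = Bᵀ * B := by
    open scoped MatrixOrder in
    exact CStarAlgebra.nonneg_iff_eq_star_mul_self.mp hS.nonneg
  have hs : Sᵀ = S := by rw [hB]; simp
  have h1 : (S * Sᵀ).trace = ∑ k, B k ⬝ᵥ S *ᵥ B k := by
    rw [hs]; nth_rw 2 [hB]
    rw [← Matrix.mul_assoc, Matrix.trace_mul_comm]
    rfl
  have h2 : S.trace = ∑ k, B k ⬝ᵥ B k := by
    rw [hB, Matrix.trace_mul_comm]; rfl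
  rw [h1, h2, Finset.mul_sum]
  exact Finset.sum_le_sum fun k _ => dotProduct_mulVec_le S _

end HaarMoments

/-! ### Averages along families of small coefficient of variation -/

/-- The average of `φ` over the entries of `σ`, normalized to have mean `1`. -/
noncomputable def normAvg {D : ℕ} (φ : ℝ → ℝ) (σ : Fin D → ℝ) : ℝ := (∑ i, φ (σ i / mean σ)) / D

/-- Families of vectors of positive mean, of any dimension, with coefficient of variation
tending to `0`. -/
noncomputable def lowCV : Filter (Σ D : ℕ, Fin D → ℝ) :=
  comap (fun p => cvSq p.2) (𝓝 0) ⊓ 𝓟 {p | 0 < mean p.2}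

lemma dim_pos_of_mean_pos {D : ℕ} {σ : Fin D → ℝ} (h : 0 < mean σ) : 0 < D := by
  rcases D.eq_zero_or_pos with rfl | hD
  · simp [mean] at h
  · exact hD

lemma mean_const {D : ℕ} (hD : 0 < D) (m : ℝ) : mean (fun _ : Fin D => m) = m := by
  have : (D : ℝ) ≠ 0 := by positivity
  simp [mean]
  field_simp

lemma normAvg_const {D : ℕ} (hD : 0 < D) {m : ℝ} (hm : 0 < m) (φ : ℝ → ℝ) :
    normAvg φ (fun _ : Fin D => m) = φ 1 := by
  have : (D : ℝ) ≠ 0 := by positivity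
  simp only [normAvg, mean_const hD, div_self hm.ne', Finset.sum_const, Finset.card_univ,
    Fintype.card_fin, nsmul_eq_mul]
  field_simp

lemma cvSq_nonneg {D : ℕ} (σ : Fin D → ℝ) : 0 ≤ cvSq σ := by
  unfold cvSq
  positivity

lemma cvSq_eq {D : ℕ} {σ : Fin D → ℝ} (h : 0 < mean σ) :
    cvSq σ = (∑ i, (σ i / mean σ - 1) ^ 2) / D := by
  have h' : ∀ i, (σ i / mean σ - 1) ^ 2 = (σ i - mean σ) ^ 2 / mean σ ^ 2 := fun i => by
    field_simp
  simp only [cvSq, h', ← Finset.sum_div]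
  rw [div_right_comm]

lemma exists_abs_sub_le_add_mul_sq {φ : ℝ → ℝ} (hc : ContinuousAt φ 1) {C : ℝ}
    (hb : ∀ u, |φ u| ≤ C * (1 + u ^ 2)) {ε : ℝ} (hε : 0 < ε) :
    ∃ K, ∀ u, |φ u - φ 1| ≤ ε + K * (u - 1) ^ 2 := by
  obtain ⟨δ, hδ, h⟩ := Metric.continuousAt_iff.1 hc ε hε
  have hC : 0 ≤ C := by
    have := (abs_nonneg _).trans (hb 0)
    linarith
  -- The growth bound gives `C * (3 + u ^ 2) ≤ C * (5 + 2 * (u - 1) ^ 2)`, the slack being `C * (u -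
  -- 2) ^ 2`; outside the `δ`-ball the constant `5 * C` is absorbed into `(u - 1) ^ 2 / δ ^ 2`.
  refine ⟨2 * C + 5 * C / δ ^ 2, fun u => ?_⟩
  by_cases hu : |u - 1| < δ
  · have h1 := h (x := u) (by rwa [Real.dist_eq])
    rw [Real.dist_eq] at h1
    have : 0 ≤ (2 * C + 5 * C / δ ^ 2) * (u - 1) ^ 2 := by positivity
    linarith
  · push Not at hu
    have h1 : δ ^ 2 ≤ (u - 1) ^ 2 := by
      rw [← sq_abs (u - 1)]
      exact pow_le_pow_left₀ hδ.le hu 2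
    have h2 : 5 * C ≤ 5 * C / δ ^ 2 * (u - 1) ^ 2 := by
      rw [div_mul_eq_mul_div, le_div_iff₀ (by positivity)]
      exact mul_le_mul_of_nonneg_left h1 (by positivity)
    have h3 := abs_sub (φ u) (φ 1)
    have h4 := hb u
    have h5 := hb 1
    nlinarith [mul_nonneg hC (sq_nonneg (u - 2))]

lemma tendsto_normAvg {φ : ℝ → ℝ} (hc : ContinuousAt φ 1) {C : ℝ}
    (hb : ∀ u, |φ u| ≤ C * (1 + u ^ 2)) :
    Tendsto (fun p : Σ D : ℕ, Fin D → ℝ => normAvg φ p.2) lowCV (𝓝 (φ 1)) := by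
  rw [Metric.tendsto_nhds]
  intro ε hε
  obtain ⟨K, hK⟩ := exists_abs_sub_le_add_mul_sq hc hb (half_pos hε)
  have h1 : Tendsto (fun p : Σ D : ℕ, Fin D → ℝ => K * cvSq p.2) lowCV (𝓝 0) := by
    have : Tendsto (fun p : Σ D : ℕ, Fin D → ℝ => cvSq p.2) lowCV (𝓝 0) :=
      tendsto_comap.mono_left inf_le_left
    simpa using this.const_mul K
  have h2 : ∀ᶠ p : Σ D : ℕ, Fin D → ℝ in lowCV, 0 < mean p.2 :=
    mem_inf_of_right (mem_principal_self _)
  filter_upwards [h1.eventually_lt_const (half_pos hε), h2] with p hp hm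
  have hD := dim_pos_of_mean_pos hm
  have hD' : (0 : ℝ) < p.1 := by exact_mod_cast hD
  rw [Real.dist_eq]
  have h3 : normAvg φ p.2 - φ 1 = (∑ i, (φ (p.2 i / mean p.2) - φ 1)) / p.1 := by
    simp only [normAvg, Finset.sum_sub_distrib, Finset.sum_const, Finset.card_univ,
      Fintype.card_fin, nsmul_eq_mul]
    field_simp
  have h4 : |normAvg φ p.2 - φ 1| ≤ ε / 2 + K * cvSq p.2 := by
    rw [h3, cvSq_eq hm, abs_div, abs_of_pos hD', div_le_iff₀ hD']
    refine (Finset.abs_sum_le_sum_abs _ _).trans ((Finset.sum_le_sum fun i _ => hK _).trans ?_)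
    rw [Finset.sum_add_distrib, ← Finset.mul_sum]
    simp only [Finset.sum_const, Finset.card_univ, Fintype.card_fin, nsmul_eq_mul]
    field_simp
    rfl
  linarith

/-! ### Correlations in the per-coordinate model -/

/-- The case `s = 0`, a Dirac mass, is included, so vanishing standard deviations need no separate
treatment. -/
lemma integral_gaussianReal_sq (s : ℝ) {g : ℝ → ℝ} (hg : Measurable g) :
    ∫ z, g z ∂gaussianReal 0 (Real.toNNReal (s ^ 2)) = ∫ z, g (s * z) ∂gaussianReal 0 1 := by
  have h := gaussianReal_map_const_mul (μ := 0) (v := 1) s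
  have hs : NNReal.mk (s ^ 2) (sq_nonneg s) = Real.toNNReal (s ^ 2) := by
    rw [Real.toNNReal_of_nonneg (sq_nonneg s)]
  rw [mul_zero, mul_one, hs] at h
  rw [← h, integral_map (by fun_prop) hg.aestronglyMeasurable]

lemma integral_gaussianReal_odd {v : NNReal} {g : ℝ → ℝ} (hg : Measurable g)
    (hodd : ∀ x, g (-x) = -g x) : ∫ z, g z ∂gaussianReal 0 v = 0 := by
  have h := gaussianReal_map_neg (μ := 0) (v := v)
  rw [neg_zero] at h
  have h1 : ∫ z, g z ∂gaussianReal 0 v = ∫ z, g (-z) ∂gaussianReal 0 v := by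
    conv_lhs => rw [← h]
    rw [integral_map (by fun_prop) hg.aestronglyMeasurable]
  simp only [hodd, integral_neg] at h1
  linarith

lemma memLp_of_bounded {Ω : Type*} [MeasurableSpace Ω] {μ : Measure Ω} [IsFiniteMeasure μ]
    {f : Ω → ℝ} (hf : Measurable f) {C : ℝ} (hb : ∀ x, |f x| ≤ C) (p : ENNReal) : MemLp f p μ :=
  MemLp.of_bound hf.aestronglyMeasurable C (.of_forall hb)

lemma memLp_id_two (v : NNReal) : MemLp (fun x => x) 2 (gaussianReal 0 v) :=
  memLp_id_gaussianReal' 2 (by simp)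

instance {D : ℕ} (σ : Fin D → ℝ) : IsProbabilityMeasure (model σ) := by
  unfold model; infer_instance

/-- The covariance of coordinate scores in the model. -/
lemma covariance_sum_model {D : ℕ} (σ : Fin D → ℝ) {f g : ℝ → ℝ} (hf : Measurable f)
    (hg : Measurable g) (hfo : ∀ x, f (-x) = -f x)
    (hf2 : ∀ v, MemLp f 2 (gaussianReal 0 v)) (hg2 : ∀ v, MemLp g 2 (gaussianReal 0 v)) :
    covariance (fun z : Fin D → ℝ => ∑ i, f (z i)) (fun z => ∑ i, g (z i)) (model σ)
      = ∑ i, ∫ z, f (σ i * z) * g (σ i * z) ∂gaussianReal 0 1 := by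
  have hmp : ∀ i, MeasurePreserving (Function.eval i) (model σ)
      (gaussianReal 0 (Real.toNNReal (σ i ^ 2))) := fun i => measurePreserving_eval _ i
  have hF : ∀ i, MemLp (fun z : Fin D → ℝ => f (z i)) 2 (model σ) :=
    fun i => (hf2 _).comp_measurePreserving (hmp i)
  have hG : ∀ i, MemLp (fun z : Fin D → ℝ => g (z i)) 2 (model σ) :=
    fun i => (hg2 _).comp_measurePreserving (hmp i)
  have hI : ∀ i {h : ℝ → ℝ}, Measurable h →
      ∫ z, h (z i) ∂model σ = ∫ z, h z ∂gaussianReal 0 (Real.toNNReal (σ i ^ 2)) := fun i h hh => by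
    rw [← (hmp i).map_eq, integral_map (hmp i).measurable.aemeasurable hh.aestronglyMeasurable]
  have hind : iIndepFun (fun i (z : Fin D → ℝ) => z i) (model σ) :=
    iIndepFun_pi (X := fun _ x => x) fun i => aemeasurable_id
  rw [covariance_fun_sum_fun_sum hF hG]
  refine Finset.sum_congr rfl fun i _ => ?_
  -- Independence kills the off-diagonal covariances; on the diagonal the product of means vanishes
  -- because `f` is odd.
  rw [Finset.sum_eq_single i]
  · rw [covariance_eq_sub (hF i) (hG i)]
    have h1 : ∫ z, f (z i) ∂model σ = 0 := by
      rw [hI i hf, integral_gaussianReal_odd hf hfo]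
    rw [h1, zero_mul, sub_zero]
    exact (hI i (hf.mul hg)).trans (integral_gaussianReal_sq (σ i) (hf.mul hg))
  · intro j _ hji
    exact ((hind.indepFun hji.symm).comp hf hg).covariance_eq_zero (hF i) (hG j)
  · simp

/-- `E[f(uZ) uZ]` for a standard Gaussian `Z`. -/
noncomputable def crossMoment (f : ℝ → ℝ) (u : ℝ) : ℝ := ∫ z, f (u * z) * (u * z) ∂gaussianReal 0 1

/-- `E[f(uZ)²]` for a standard Gaussian `Z`. -/
noncomputable def sqMoment (f : ℝ → ℝ) (u : ℝ) : ℝ := ∫ z, f (u * z) ^ 2 ∂gaussianReal 0 1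

lemma integral_sq_gaussianReal : ∫ z, z ^ 2 ∂gaussianReal 0 1 = 1 := by
  have h := variance_fun_id_gaussianReal (μ := 0) (v := 1)
  rw [variance_eq_sub (memLp_id_two 1), integral_id_gaussianReal] at h
  simpa using h

/-- The correlation of a coordinate score with the unquantized one. -/
lemma corr_sum_score {D : ℕ} {σ : Fin D → ℝ} (hm : 0 < mean σ) {f g : ℝ → ℝ} (hf : Measurable f)
    (hfo : ∀ x, f (-x) = -f x) {C : ℝ} (hb : ∀ x, |f x| ≤ C)
    (hfg : ∀ x, f (mean σ * x) = g x) :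
    corr (fun z : Fin D → ℝ => ∑ i, f (z i)) score (model σ)
      = normAvg (crossMoment g) σ /
        Real.sqrt (normAvg (sqMoment g) σ * normAvg (fun u => u ^ 2) σ) := by
  have hD := dim_pos_of_mean_pos hm
  have hD' : (0 : ℝ) < D := by exact_mod_cast hD
  have hf2 : ∀ v, MemLp f 2 (gaussianReal 0 v) := fun v => memLp_of_bounded hf hb 2
  have hFae : AEMeasurable (fun z : Fin D → ℝ => ∑ i, f (z i)) (model σ) :=
    (Finset.measurable_sum _ fun i _ => hf.comp (measurable_pi_apply i)).aemeasurable
  have hGae : AEMeasurable (fun z : Fin D → ℝ => ∑ i, z i) (model σ) := by fun_prop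
  have hs : ∀ i, σ i = mean σ * (σ i / mean σ) := fun i => by field_simp
  -- This trades `f`, which may depend on `σ` through the threshold, for `g` in units of the mean.
  have hfs : ∀ i z, f (σ i * z) = g (σ i / mean σ * z) := fun i z => by
    rw [← hfg, ← mul_assoc, ← hs]
  have c1 : covariance (fun z : Fin D → ℝ => ∑ i, f (z i)) score (model σ)
      = mean σ * D * normAvg (crossMoment g) σ := by
    refine (covariance_sum_model σ hf measurable_id hfo hf2 memLp_id_two).trans ?_
    have : ∀ i, ∫ z, f (σ i * z) * id (σ i * z) ∂gaussianReal 0 1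
        = mean σ * crossMoment g (σ i / mean σ) := fun i => by
      rw [crossMoment, ← integral_const_mul]
      refine integral_congr_ae (.of_forall fun z => ?_)
      simp only [hfs, id]
      nth_rw 2 [hs i]
      ring
    simp only [this, ← Finset.mul_sum, normAvg]
    field_simp
  have c2 : variance (fun z : Fin D → ℝ => ∑ i, f (z i)) (model σ)
      = D * normAvg (sqMoment g) σ := by
    rw [← covariance_self hFae, covariance_sum_model σ hf hf hfo hf2 hf2]
    simp only [hfs, ← sq, normAvg, sqMoment]
    field_simp
  have c3 : variance (score : (Fin D → ℝ) → ℝ) (model σ)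
      = mean σ ^ 2 * D * normAvg (fun u => u ^ 2) σ := by
    have : (score : (Fin D → ℝ) → ℝ) = fun z => ∑ i, z i := rfl
    rw [this, ← covariance_self hGae]
    refine (covariance_sum_model σ measurable_id measurable_id (fun _ => rfl) memLp_id_two
      memLp_id_two).trans ?_
    have : ∀ i, ∫ z, id (σ i * z) * id (σ i * z) ∂gaussianReal 0 1
        = mean σ ^ 2 * (σ i / mean σ) ^ 2 := fun i => by
      simp only [id, ← sq, mul_pow, integral_const_mul, integral_sq_gaussianReal]
      field_simp
    simp only [this, ← Finset.mul_sum, normAvg]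
    field_simp
  rw [corr, c1, c2, c3]
  have h4 : D * normAvg (sqMoment g) σ * (mean σ ^ 2 * D * normAvg (fun u => u ^ 2) σ)
      = (mean σ * D) ^ 2 * (normAvg (sqMoment g) σ * normAvg (fun u => u ^ 2) σ) := by ring
  rw [h4, Real.sqrt_mul (by positivity), Real.sqrt_sq (by positivity),
    mul_div_mul_left _ _ (by positivity)]

/-! ### Continuity of the moments -/

lemma integrable_sq_gaussianReal : Integrable (fun z => z ^ 2) (gaussianReal 0 1) :=
  (memLp_id_two 1).integrable_sq

lemma abs_crossMoment_le {f : ℝ → ℝ} {C : ℝ} (hb : ∀ x, |f x| ≤ C) (u : ℝ) :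
    |crossMoment f u| ≤ C * (1 + u ^ 2) := by
  have hC : 0 ≤ C := (abs_nonneg _).trans (hb 0)
  have h1 : Integrable (fun z => C * (1 + u ^ 2 * z ^ 2) / 2) (gaussianReal 0 1) :=
    (((integrable_const _).add (integrable_sq_gaussianReal.const_mul _)).const_mul _).div_const _
  have h2 : ∫ z, C * (1 + u ^ 2 * z ^ 2) / 2 ∂gaussianReal 0 1 = C * (1 + u ^ 2) / 2 := by
    rw [integral_div, integral_const_mul, integral_add (integrable_const _)
      (integrable_sq_gaussianReal.const_mul _), integral_const_mul, integral_sq_gaussianReal]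
    simp
  have h4 : ‖∫ z, f (u * z) * (u * z) ∂gaussianReal 0 1‖
      ≤ ∫ z, C * (1 + u ^ 2 * z ^ 2) / 2 ∂gaussianReal 0 1 := by
    refine norm_integral_le_of_norm_le h1 (.of_forall fun z => ?_)
    rw [Real.norm_eq_abs, abs_mul]
    have h3 : |u * z| ≤ (1 + u ^ 2 * z ^ 2) / 2 := by
      rw [← mul_pow, ← sq_abs (u * z)]
      nlinarith [sq_nonneg (|u * z| - 1)]
    calc |f (u * z)| * |u * z| ≤ C * ((1 + u ^ 2 * z ^ 2) / 2) := by gcongr; exact hb _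
      _ = _ := by ring
  rw [h2, Real.norm_eq_abs] at h4
  have : 0 ≤ C * (1 + u ^ 2) := by positivity
  exact h4.trans (by linarith)

lemma abs_sqMoment_le {f : ℝ → ℝ} {C : ℝ} (hb : ∀ x, |f x| ≤ C) (u : ℝ) :
    |sqMoment f u| ≤ C ^ 2 * (1 + u ^ 2) := by
  have h : ‖∫ z, f (u * z) ^ 2 ∂gaussianReal 0 1‖ ≤ ∫ _, C ^ 2 ∂gaussianReal 0 1 := by
    refine norm_integral_le_of_norm_le (integrable_const _) (.of_forall fun z => ?_)
    rw [Real.norm_eq_abs, abs_pow]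
    exact pow_le_pow_left₀ (abs_nonneg _) (hb _) 2
  simp only [integral_const, probReal_univ, one_smul] at h
  exact h.trans (by nlinarith [mul_nonneg (sq_nonneg C) (sq_nonneg u)])

lemma continuousAt_comp_mul_one {f : ℝ → ℝ} {z : ℝ} (hz : ContinuousAt f z) :
    ContinuousAt (fun u => f (u * z)) 1 := by
  refine ContinuousAt.comp (f := fun u : ℝ => u * z) (by simpa using hz) (by fun_prop)

/-- Dominated convergence: the jumps of `f` form a null set, so `u ↦ f (u * z)` is continuous at `1`
for almost every `z`. -/
lemma continuousAt_crossMoment {f : ℝ → ℝ} (hf : Measurable f) {C : ℝ} (hb : ∀ x, |f x| ≤ C)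
    (hc : ∀ᵐ z ∂gaussianReal 0 1, ContinuousAt f z) : ContinuousAt (crossMoment f) 1 := by
  have hC : 0 ≤ C := (abs_nonneg _).trans (hb 0)
  refine continuousAt_of_dominated (bound := fun z => C * (2 * |z|)) (.of_forall fun u => ?_) ?_ ?_ ?_
  · exact (Measurable.mul (by fun_prop) (by fun_prop)).aestronglyMeasurable
  · have : ∀ᶠ u : ℝ in 𝓝 1, |u| < 2 :=
      (continuous_abs.tendsto (1 : ℝ)).eventually_lt_const (by norm_num)
    filter_upwards [this] with u hu
    refine .of_forall fun z => ?_
    rw [Real.norm_eq_abs, abs_mul, abs_mul]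
    gcongr
    exact hb _
  · exact (((memLp_id_two 1).integrable one_le_two).abs.const_mul 2).const_mul C
  · filter_upwards [hc] with z hz
    exact (continuousAt_comp_mul_one hz).mul (by fun_prop)

lemma continuousAt_sqMoment {f : ℝ → ℝ} (hf : Measurable f) {C : ℝ} (hb : ∀ x, |f x| ≤ C)
    (hc : ∀ᵐ z ∂gaussianReal 0 1, ContinuousAt f z) : ContinuousAt (sqMoment f) 1 := by
  refine continuousAt_of_dominated (bound := fun _ => C ^ 2) (.of_forall fun u => ?_)
    (.of_forall fun u => .of_forall fun z => ?_) (integrable_const _) ?_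
  · exact (Measurable.pow_const (by fun_prop) 2).aestronglyMeasurable
  · rw [Real.norm_eq_abs, abs_pow]
    exact pow_le_pow_left₀ (abs_nonneg _) (hb _) 2
  · filter_upwards [hc] with z hz
    exact (continuousAt_comp_mul_one hz).pow 2

/-- The correlation of the coordinate score `f` with the unquantized one, for equal standard
deviations `1`. -/
noncomputable def isoCorr (f : ℝ → ℝ) : ℝ := crossMoment f 1 / Real.sqrt (sqMoment f 1)

lemma tendsto_normAvg_div {f : ℝ → ℝ} (hf : Measurable f) {C : ℝ} (hb : ∀ x, |f x| ≤ C)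
    (hc : ∀ᵐ z ∂gaussianReal 0 1, ContinuousAt f z) (hpos : 0 < sqMoment f 1) :
    Tendsto (fun p : Σ D : ℕ, Fin D → ℝ => normAvg (crossMoment f) p.2 /
      Real.sqrt (normAvg (sqMoment f) p.2 * normAvg (fun u => u ^ 2) p.2)) lowCV
      (𝓝 (isoCorr f)) := by
  have h1 := tendsto_normAvg (continuousAt_crossMoment hf hb hc) (abs_crossMoment_le hb)
  have h2 := tendsto_normAvg (continuousAt_sqMoment hf hb hc) (abs_sqMoment_le hb)
  have h3 := tendsto_normAvg (φ := fun u => u ^ 2) (by fun_prop) (C := 1) fun u => by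
    rw [abs_of_nonneg (sq_nonneg u)]; linarith
  have h4 := h1.div (h2.mul h3).sqrt (by simpa using (Real.sqrt_pos.2 hpos).ne')
  simpa [isoCorr, Pi.div_def] using h4

/-! ### The one-bit and two-bit coordinate scores -/

/-- The two-bit coordinate score. -/
noncomputable def twoBit (α t : ℝ) : ℝ := (1 + magBit α t) * Real.sign t

/-- The magnitude threshold for unit standard deviations: `E|Z|`. -/
noncomputable def meanAbs : ℝ := Real.sqrt (2 / Real.pi)

lemma meanAbs_pos : 0 < meanAbs := Real.sqrt_pos.2 (by positivity)

lemma meanAbs_sq : meanAbs ^ 2 = 2 / Real.pi := Real.sq_sqrt (by positivity)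

lemma measurable_magBit (α : ℝ) : Measurable (magBit α) := by
  unfold magBit
  exact Measurable.ite (measurableSet_lt measurable_const measurable_abs) measurable_const
    measurable_const

lemma measurable_sign : Measurable Real.sign := by
  unfold Real.sign
  exact Measurable.ite measurableSet_Iio measurable_const
    (Measurable.ite measurableSet_Ioi measurable_const measurable_const)

lemma measurable_twoBit (α : ℝ) : Measurable (twoBit α) :=
  (measurable_const.add (measurable_magBit α)).mul measurable_sign

lemma abs_sign_le (x : ℝ) : |Real.sign x| ≤ 1 := by
  rcases Real.sign_apply_eq x with h | h | h <;> simp [h]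

lemma magBit_mem (α t : ℝ) : 0 ≤ magBit α t ∧ magBit α t ≤ 1 := by
  unfold magBit
  split_ifs <;> simp

lemma abs_twoBit_le (α x : ℝ) : |twoBit α x| ≤ 2 := by
  obtain ⟨h1, h2⟩ := magBit_mem α x
  rw [twoBit, abs_mul, abs_of_nonneg (by linarith)]
  nlinarith [abs_sign_le x, abs_nonneg (Real.sign x)]

lemma twoBit_neg (α x : ℝ) : twoBit α (-x) = -twoBit α x := by
  simp [twoBit, magBit, Real.sign_neg]

lemma sign_mul_of_pos {m : ℝ} (hm : 0 < m) (x : ℝ) : Real.sign (m * x) = Real.sign x := by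
  rcases lt_trichotomy x 0 with h | rfl | h
  · rw [Real.sign_of_neg h, Real.sign_of_neg (mul_neg_of_pos_of_neg hm h)]
  · simp
  · rw [Real.sign_of_pos h, Real.sign_of_pos (mul_pos hm h)]

/-- With `m = mean σ`, this scale invariance reduces every threshold to `meanAbs`. -/
lemma twoBit_mul_of_pos {m : ℝ} (hm : 0 < m) (α x : ℝ) : twoBit (α * m) (m * x) = twoBit α x := by
  have : α * m < |m * x| ↔ α < |x| := by
    rw [abs_mul, abs_of_pos hm, mul_comm m, mul_lt_mul_iff_left₀ hm]
  simp only [twoBit, magBit, sign_mul_of_pos hm, this]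

lemma continuousAt_sign {z : ℝ} (hz : z ≠ 0) : ContinuousAt Real.sign z := by
  rcases hz.lt_or_gt with h | h
  · refine continuousAt_const.congr (f := fun _ => -1) ?_
    filter_upwards [eventually_lt_nhds h] with x hx using (Real.sign_of_neg hx).symm
  · refine continuousAt_const.congr (f := fun _ => 1) ?_
    filter_upwards [eventually_gt_nhds h] with x hx using (Real.sign_of_pos hx).symm

lemma continuousAt_magBit {α z : ℝ} (hz : |z| ≠ α) : ContinuousAt (magBit α) z := by
  have hc := continuous_abs.continuousAt (x := z)
  rcases hz.lt_or_gt with h | h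
  · refine continuousAt_const.congr (f := fun _ => 0) ?_
    filter_upwards [hc.eventually_lt_const h] with x hx
    simp [magBit, hx.le]
  · refine continuousAt_const.congr (f := fun _ => 1) ?_
    filter_upwards [hc.eventually_const_lt h] with x hx
    simp [magBit, hx]

lemma ae_ne_gaussianReal (a : ℝ) : ∀ᵐ z ∂gaussianReal 0 1, z ≠ a := by
  have := nullSingletonClass_gaussianReal (μ := 0) (v := 1) one_ne_zero
  exact Measure.ae_ne _ a

lemma ae_continuousAt_sign : ∀ᵐ z ∂gaussianReal 0 1, ContinuousAt Real.sign z := by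
  filter_upwards [ae_ne_gaussianReal 0] with z hz using continuousAt_sign hz

lemma ae_continuousAt_twoBit (α : ℝ) : ∀ᵐ z ∂gaussianReal 0 1, ContinuousAt (twoBit α) z := by
  filter_upwards [ae_ne_gaussianReal 0, ae_ne_gaussianReal α, ae_ne_gaussianReal (-α)]
    with z h0 h1 h2
  have : |z| ≠ α := fun h => by
    rcases abs_choice z with h' | h'
    · exact h1 (h'.symm.trans h)
    · exact h2 (by linarith)
  exact (continuousAt_const.add (continuousAt_magBit this)).mul (continuousAt_sign h0)

/-! ### Gaussian integrals -/

lemma gaussianPDFReal_std (z : ℝ) :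
    gaussianPDFReal 0 1 z = meanAbs / 2 * Real.exp (-z ^ 2 / 2) := by
  have h : (Real.sqrt (2 * Real.pi))⁻¹ = meanAbs / 2 := by
    rw [meanAbs, ← Real.sqrt_inv, div_eq_mul_inv, ← Real.sqrt_sq (show (0 : ℝ) ≤ 2⁻¹ by norm_num),
      ← Real.sqrt_mul (by positivity)]
    congr 1
    field_simp
  rw [gaussianPDFReal, NNReal.coe_one, mul_one, mul_one, sub_zero, h]

/-- By evenness the integral is twice the one over `y > a`, where `y * exp (-y ^ 2 / 2)` has the
antiderivative `-exp (-y ^ 2 / 2)`. -/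
lemma integral_abs_mul_magBit {a : ℝ} (ha : 0 ≤ a) :
    ∫ z, magBit a z * |z| ∂gaussianReal 0 1 = meanAbs * Real.exp (-a ^ 2 / 2) := by
  rw [integral_gaussianReal_eq_integral_smul one_ne_zero]
  have h1 : ∀ z, gaussianPDFReal 0 1 z • (magBit a z * |z|)
      = (fun y => meanAbs / 2 * (magBit a y * (y * Real.exp (-y ^ 2 / 2)))) |z| := fun z => by
    simp only [gaussianPDFReal_std, smul_eq_mul, sq_abs, magBit, abs_abs]
    ring
  simp only [h1]
  rw [integral_comp_abs (f := fun y => meanAbs / 2 * (magBit a y * (y * Real.exp (-y ^ 2 / 2)))),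
    integral_const_mul]
  have h2 : ∫ y in Set.Ioi (0 : ℝ), magBit a y * (y * Real.exp (-y ^ 2 / 2))
      = ∫ y in Set.Ioi a, y * Real.exp (-y ^ 2 / 2) := by
    rw [← integral_indicator measurableSet_Ioi, ← integral_indicator measurableSet_Ioi]
    congr 1
    ext y
    by_cases hy : a < y
    · have hy0 : 0 < y := ha.trans_lt hy
      simp [Set.indicator, hy, hy0, magBit, abs_of_pos hy0]
    · by_cases hy0 : 0 < y
      · simp [Set.indicator, hy, hy0, magBit, abs_of_pos hy0]
      · simp [Set.indicator, hy, hy0]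
  have hd : ∀ x ∈ Set.Ici a, HasDerivAt (fun y : ℝ => -Real.exp (-y ^ 2 / 2))
      (x * Real.exp (-x ^ 2 / 2)) x := fun x _ => by
    have : HasDerivAt (fun y : ℝ => -y ^ 2 / 2) (-x) x := by
      have := ((hasDerivAt_pow 2 x).neg).div_const 2
      convert! this using 1
      simp; ring
    convert! this.exp.neg using 1
    ring
  have hlim : Tendsto (fun y : ℝ => -Real.exp (-y ^ 2 / 2)) atTop (𝓝 0) := by
    have h : Tendsto (fun y : ℝ => -y ^ 2 / 2) atTop atBot := by
      have : Tendsto (fun y : ℝ => y ^ 2 / 2) atTop atTop :=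
        (tendsto_pow_atTop two_ne_zero).atTop_div_const two_pos
      refine (tendsto_neg_atTop_atBot.comp this).congr fun y => ?_
      simp [neg_div]
    simpa using (Real.tendsto_exp_atBot.comp h).neg
  have h3 := integral_Ioi_of_hasDerivAt_of_nonneg' hd
    (fun x hx => mul_nonneg (ha.trans (le_of_lt hx)) (Real.exp_pos _).le) hlim
  rw [h2, h3]
  ring

lemma integral_abs_gaussianReal : ∫ z, |z| ∂gaussianReal 0 1 = meanAbs := by
  have h := integral_abs_mul_magBit le_rfl
  rw [zero_pow two_ne_zero, neg_zero, zero_div, Real.exp_zero, mul_one] at h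
  rw [← h]
  refine integral_congr_ae ?_
  filter_upwards [ae_ne_gaussianReal 0] with z hz
  simp [magBit, hz]

lemma integrable_magBit (a : ℝ) : Integrable (magBit a) (gaussianReal 0 1) :=
  Integrable.of_bound (measurable_magBit a).aestronglyMeasurable 1 (.of_forall fun z => by
    rw [Real.norm_eq_abs, abs_of_nonneg (magBit_mem a z).1]
    exact (magBit_mem a z).2)

/-- The Gaussian mass outside `[-a, a]` is controlled by the density at `a`. -/
lemma integral_magBit_le {a : ℝ} (ha : 0 ≤ a) :
    ∫ z, magBit a z ∂gaussianReal 0 1 ≤ 1 - a * meanAbs * Real.exp (-a ^ 2 / 2) := by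
  have h1 : ∫ z, (1 - magBit a z) ∂gaussianReal 0 1 = 1 - ∫ z, magBit a z ∂gaussianReal 0 1 := by
    rw [integral_sub (integrable_const _) (integrable_magBit a)]
    simp
  rw [integral_gaussianReal_eq_integral_smul one_ne_zero] at h1
  -- The rectangle over `[-a, a]` of height the density at `a` lies under the density.
  have h2 : ∫ z, (Set.Icc (-a) a).indicator (fun _ => gaussianPDFReal 0 1 a) z
      = a * meanAbs * Real.exp (-a ^ 2 / 2) := by
    rw [integral_indicator measurableSet_Icc, setIntegral_const, gaussianPDFReal_std]
    simp only [Measure.real, Real.volume_Icc, smul_eq_mul]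
    rw [ENNReal.toReal_ofReal (by linarith)]
    ring
  have h3 : ∫ z, (Set.Icc (-a) a).indicator (fun _ => gaussianPDFReal 0 1 a) z
      ≤ ∫ z, gaussianPDFReal 0 1 z • (1 - magBit a z) := by
    refine integral_mono ?_ ?_ fun z => ?_
    · exact (integrableOn_const (by simp)).integrable_indicator measurableSet_Icc
    · refine (integrable_gaussianPDFReal 0 1).mono
        ((measurable_gaussianPDFReal 0 1).smul
          (measurable_const.sub (measurable_magBit a))).aestronglyMeasurable
        (.of_forall fun z => ?_)
      obtain ⟨g1, g2⟩ := magBit_mem a z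
      rw [norm_smul]
      refine mul_le_of_le_one_right (norm_nonneg _) ?_
      rw [Real.norm_eq_abs, abs_of_nonneg (by linarith)]
      linarith
    · by_cases hz : z ∈ Set.Icc (-a) a
      · have hz' : |z| ≤ a := abs_le.2 hz
        have hsq : z ^ 2 ≤ a ^ 2 := sq_le_sq' hz.1 hz.2
        simp only [Set.indicator_of_mem hz, magBit, not_lt.2 hz', if_false, gaussianPDFReal_std,
          sub_zero, smul_eq_mul, mul_one]
        have := meanAbs_pos
        gcongr
      · rw [Set.indicator_of_notMem hz]
        exact smul_nonneg (gaussianPDFReal_nonneg _ _ _) (by linarith [(magBit_mem a z).2])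
  linarith

lemma sign_mul_self_eq (z : ℝ) : Real.sign z * z = |z| := by
  rcases lt_trichotomy z 0 with h | rfl | h
  · rw [Real.sign_of_neg h, abs_of_neg h]; ring
  · simp
  · rw [Real.sign_of_pos h, abs_of_pos h]; ring

lemma sign_sq_eq {z : ℝ} (hz : z ≠ 0) : Real.sign z ^ 2 = 1 := by
  rcases Real.sign_apply_eq_of_ne_zero z hz with h | h <;> simp [h]

lemma crossMoment_sign : crossMoment Real.sign 1 = meanAbs := by
  simp only [crossMoment, one_mul, sign_mul_self_eq, integral_abs_gaussianReal]

lemma sqMoment_sign : sqMoment Real.sign 1 = 1 := by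
  have : ∫ z, Real.sign z ^ 2 ∂gaussianReal 0 1 = ∫ _, (1 : ℝ) ∂gaussianReal 0 1 := by
    refine integral_congr_ae ?_
    filter_upwards [ae_ne_gaussianReal 0] with z hz using sign_sq_eq hz
  simpa [sqMoment] using this

lemma crossMoment_twoBit {a : ℝ} (ha : 0 ≤ a) :
    crossMoment (twoBit a) 1 = meanAbs * (1 + Real.exp (-a ^ 2 / 2)) := by
  have hI : Integrable (fun z : ℝ => |z|) (gaussianReal 0 1) :=
    ((memLp_id_two 1).integrable one_le_two).abs
  have hI2 : Integrable (fun z : ℝ => magBit a z * |z|) (gaussianReal 0 1) := by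
    refine hI.mono ((measurable_magBit a).mul measurable_abs).aestronglyMeasurable
      (.of_forall fun z => ?_)
    rw [norm_mul]
    refine mul_le_of_le_one_left (norm_nonneg _) ?_
    rw [Real.norm_eq_abs, abs_of_nonneg (magBit_mem a z).1]
    exact (magBit_mem a z).2
  have h : ∀ z, twoBit a z * z = |z| + magBit a z * |z| := fun z => by
    rw [twoBit, mul_assoc, sign_mul_self_eq]; ring
  simp only [crossMoment, one_mul, h]
  rw [integral_add hI hI2, integral_abs_gaussianReal, integral_abs_mul_magBit ha]
  ring

/-- Off the origin the squared score is `1` or `4`, that is, `1` plus three times the magnitude bit.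
-/
lemma sqMoment_twoBit (a : ℝ) :
    sqMoment (twoBit a) 1 = 1 + 3 * ∫ z, magBit a z ∂gaussianReal 0 1 := by
  have h : ∫ z, twoBit a z ^ 2 ∂gaussianReal 0 1
      = ∫ z, (1 + 3 * magBit a z) ∂gaussianReal 0 1 := by
    refine integral_congr_ae ?_
    filter_upwards [ae_ne_gaussianReal 0] with z hz
    rw [twoBit, mul_pow, sign_sq_eq hz]
    unfold magBit
    split_ifs <;> norm_num
  simp only [sqMoment, one_mul, h]
  rw [integral_add (integrable_const _) ((integrable_magBit a).const_mul 3), integral_const_mul]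
  simp

lemma sqMoment_twoBit_pos (a : ℝ) : 0 < sqMoment (twoBit a) 1 := by
  have : 0 ≤ ∫ z, magBit a z ∂gaussianReal 0 1 := integral_nonneg fun z => (magBit_mem a z).1
  rw [sqMoment_twoBit]
  linarith

/-- Two bits beat one bit for equal standard deviations. -/
lemma isoCorr_sign_lt_isoCorr_twoBit : isoCorr Real.sign < isoCorr (twoBit meanAbs) := by
  have hc := meanAbs_pos
  have hp := integral_magBit_le hc.le
  have hs := sqMoment_twoBit meanAbs
  have he : -meanAbs ^ 2 / 2 = -(1 / Real.pi) := by
    rw [meanAbs_sq]; ring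
  have hcc : meanAbs * meanAbs = 2 * (1 / Real.pi) := by
    rw [← sq, meanAbs_sq]; ring
  rw [he, hcc] at hp
  rw [isoCorr, isoCorr, crossMoment_sign, sqMoment_sign, crossMoment_twoBit hc.le, he,
    Real.sqrt_one, div_one, lt_div_iff₀ (Real.sqrt_pos.2 (sqMoment_twoBit_pos _))]
  refine mul_lt_mul_of_pos_left ?_ hc
  set e := Real.exp (-(1 / Real.pi))
  have h1 : 1 - 1 / Real.pi ≤ e := by
    have := Real.add_one_le_exp (-(1 / Real.pi))
    linarith
  have h2 : 1 / Real.pi < 0.32 := by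
    rw [div_lt_iff₀ Real.pi_pos]
    linarith [Real.pi_gt_d2]
  have h3 : 0.317 < 1 / Real.pi := by
    rw [lt_div_iff₀ Real.pi_pos]
    linarith [Real.pi_lt_d2]
  -- With `x = 1 / π` and `p` the tail mass, the goal is `1 + 3p < (1 + e)²`. Inserting `p ≤ 1 -
  -- 2xe` and then `e ≥ 1 - x` leaves `5x² < 2x`, true since `0 < x < 2/5`.
  rw [Real.sqrt_lt' (by linarith), hs]
  nlinarith

/-! ### The fidelities -/

lemma rho1_eq {D : ℕ} {σ : Fin D → ℝ} (hm : 0 < mean σ) :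
    rho1 σ = normAvg (crossMoment Real.sign) σ /
      Real.sqrt (normAvg (sqMoment Real.sign) σ * normAvg (fun u => u ^ 2) σ) :=
  corr_sum_score hm measurable_sign (fun _ => Real.sign_neg) abs_sign_le (sign_mul_of_pos hm)

lemma rho2_eq {D : ℕ} {σ : Fin D → ℝ} (hm : 0 < mean σ) :
    rho2 σ = normAvg (crossMoment (twoBit meanAbs)) σ /
      Real.sqrt (normAvg (sqMoment (twoBit meanAbs)) σ * normAvg (fun u => u ^ 2) σ) :=
  corr_sum_score hm (measurable_twoBit (threshold σ)) (twoBit_neg _) (abs_twoBit_le _)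
    (twoBit_mul_of_pos hm meanAbs)

/-- The two-bit advantage for equal standard deviations. -/
noncomputable def isoAdvantage : ℝ := isoCorr (twoBit meanAbs) - isoCorr Real.sign

lemma isoGain_eq {D : ℕ} {σ : Fin D → ℝ} (hm : 0 < mean σ) : isoGain σ = isoAdvantage := by
  have hD := dim_pos_of_mean_pos hm
  have hm' : 0 < mean (fun _ : Fin D => mean σ) := by rwa [mean_const hD]
  rw [isoGain, rho1_eq hm', rho2_eq hm']
  simp [normAvg_const hD hm, isoAdvantage, isoCorr]

lemma tendsto_advantage :
    Tendsto (fun p : Σ D : ℕ, Fin D → ℝ => advantage p.2) lowCV (𝓝 isoAdvantage) := by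
  have h1 := tendsto_normAvg_div measurable_sign abs_sign_le ae_continuousAt_sign
    (by rw [sqMoment_sign]; exact one_pos)
  have h2 := tendsto_normAvg_div (measurable_twoBit meanAbs) (abs_twoBit_le _)
    (ae_continuousAt_twoBit _) (sqMoment_twoBit_pos _)
  refine (h2.sub h1).congr' ?_
  filter_upwards [mem_inf_of_right (mem_principal_self _)] with p (hp : 0 < mean p.2)
  rw [advantage, rho1_eq hp, rho2_eq hp]

lemma exists_abs_advantage_sub_lt {ε : ℝ} (hε : 0 < ε) : ∃ δ > 0, ∀ (D : ℕ) (σ : Fin D → ℝ),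
    0 < mean σ → cvSq σ < δ → |advantage σ - isoAdvantage| < ε := by
  have h := Metric.tendsto_nhds.1 tendsto_advantage ε hε
  rw [lowCV, eventually_inf_principal, eventually_comap] at h
  obtain ⟨δ, hδ, h⟩ := Metric.eventually_nhds_iff.1 h
  refine ⟨δ, hδ, fun D σ hm hcv => ?_⟩
  refine h (y := cvSq σ) ?_ ⟨D, σ⟩ rfl hm
  rwa [Real.dist_eq, sub_zero, abs_of_nonneg (cvSq_nonneg σ)]

/-! ### Rotated standard deviations -/

/-- The relative mean square deviation of the diagonal of `Q S Qᵀ` from its mean. -/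
noncomputable def diagDev {D : ℕ} (S : Matrix (Fin D) (Fin D) ℝ) (Q : Orth D) : ℝ :=
  (∑ i, ((Q.1 * S * Q.1.transpose) i i - S.trace / D) ^ 2) / D / (S.trace / D) ^ 2

/-- Since `(√x - √t)² ≤ (x - t)² / t`, the roots lie within mean square `t * V` of `√t`. This forces
`m² ≥ t * (1 - V)` for their mean `m`; their variance is `t - m² ≤ t * V`. -/
lemma mean_sqrt_pos_and_cvSq_le {D : ℕ} {x : Fin D → ℝ} (hx : ∀ i, 0 ≤ x i) {t : ℝ} (ht : 0 < t)
    (hD : 0 < D) (hsum : ∑ i, x i = D * t) {V : ℝ} (hV : (∑ i, (x i - t) ^ 2) / D / t ^ 2 = V)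
    (hV1 : V < 1) :
    0 < mean (fun i => Real.sqrt (x i)) ∧ cvSq (fun i => Real.sqrt (x i)) ≤ V / (1 - V) := by
  have hD' : (0 : ℝ) < D := by exact_mod_cast hD
  set σ : Fin D → ℝ := fun i => Real.sqrt (x i)
  set m := mean σ with hm
  have hmsum : ∑ i, σ i = D * m := by rw [hm, mean]; field_simp
  have hm0 : 0 ≤ m := div_nonneg (Finset.sum_nonneg fun i _ => Real.sqrt_nonneg _) hD'.le
  have hsq : ∀ i, σ i ^ 2 = x i := fun i => Real.sq_sqrt (hx i)
  set s := Real.sqrt t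
  have hs : s ^ 2 = t := Real.sq_sqrt ht.le
  have hs0 : 0 ≤ s := Real.sqrt_nonneg _
  have hvar : ∀ c, ∑ i, (σ i - c) ^ 2 = D * (t - 2 * c * m + c ^ 2) := fun c => by
    simp only [sub_sq, Finset.sum_add_distrib, Finset.sum_sub_distrib, ← Finset.sum_mul,
      ← Finset.mul_sum, hsq, hsum, hmsum, Finset.sum_const, Finset.card_univ, Fintype.card_fin,
      nsmul_eq_mul]
    ring
  have hpt : ∀ i, (σ i - s) ^ 2 ≤ (x i - t) ^ 2 / t := fun i => by
    rw [le_div_iff₀ ht, ← hsq i, ← hs]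
    have h0 : 0 ≤ σ i := Real.sqrt_nonneg _
    have : (σ i ^ 2 - s ^ 2) ^ 2 = (σ i - s) ^ 2 * (σ i + s) ^ 2 := by ring
    rw [this]
    refine mul_le_mul_of_nonneg_left ?_ (sq_nonneg _)
    exact pow_le_pow_left₀ hs0 (by linarith) 2
  have h1 : ∑ i, (σ i - s) ^ 2 ≤ D * (t * V) := by
    refine (Finset.sum_le_sum fun i _ => hpt i).trans (le_of_eq ?_)
    rw [← Finset.sum_div, ← hV]
    field_simp
  rw [hvar] at h1
  have h2 := le_of_mul_le_mul_left h1 hD'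
  -- Uses `m² ≥ 2ms - s²`.
  have h3 : t * (1 - V) ≤ m ^ 2 := by nlinarith [sq_nonneg (m - s)]
  have h4 : 0 < t * (1 - V) := mul_pos ht (by linarith)
  have hmpos : 0 < m := by
    rcases hm0.eq_or_lt with h | h
    · rw [← h] at h3; linarith
    · exact h
  refine ⟨hmpos, ?_⟩
  rw [cvSq, ← hm, hvar, mul_div_cancel_left₀ _ hD'.ne', div_le_div_iff₀ (by positivity) (by linarith)]
  nlinarith

lemma mean_rotatedStd_pos_and_cvSq_le {D : ℕ} {S : Matrix (Fin D) (Fin D) ℝ} (hS : S.PosSemidef)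
    (htr : 0 < S.trace) (Q : Orth D) (hV : diagDev S Q < 1) :
    0 < mean (rotatedStd S Q) ∧ cvSq (rotatedStd S Q) ≤ diagDev S Q / (1 - diagDev S Q) := by
  have hD : 0 < D := by
    rcases D.eq_zero_or_pos with rfl | hD
    · simp [Matrix.trace] at htr
    · exact hD
  have hD' : (0 : ℝ) < D := by exact_mod_cast hD
  have hpsd : (Q.1 * S * Q.1.transpose).PosSemidef := by
    simpa using hS.mul_mul_conjTranspose_same Q.1
  refine mean_sqrt_pos_and_cvSq_le (x := fun i => (Q.1 * S * Q.1.transpose) i i)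
    (fun i => hpsd.diag_nonneg) (t := S.trace / D) (by positivity) hD ?_ rfl hV
  rw [sum_diag_conj]
  field_simp

lemma integral_diagDev_le {D : ℕ} {S : Matrix (Fin D) (Fin D) ℝ} (hS : S.PosSemidef)
    (htr : 0 < S.trace) : ∫ Q, diagDev S Q ∂haarOrth D ≤ 2 / effRank S := by
  have hD : 0 < D := by
    rcases D.eq_zero_or_pos with rfl | hD
    · simp [Matrix.trace] at htr
    · exact hD
  have hD' : (0 : ℝ) < D := by exact_mod_cast hD
  have hsymm : S.IsSymm := by
    have h := hS.1.eq
    rwa [Matrix.conjTranspose_eq_transpose_of_trivial] at h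
  have h1 := integral_sum_sq_diag_sub_le S hsymm
  have h2 := trace_mul_transpose_le hS
  simp only [diagDev, integral_div]
  rw [effRank, div_div_eq_mul_div, div_div, div_le_div_iff₀ (by positivity) htr]
  have h3 : (D : ℝ) * (S.trace / D) ^ 2 = S.trace ^ 2 / D := by field_simp
  rw [h3]
  set I := ∫ Q : Orth D, ∑ i, ((Q.1 * S * Q.1.transpose) i i - S.trace / D) ^ 2 ∂haarOrth D
  set N := ‖Matrix.toEuclideanCLM (n := Fin D) (𝕜 := ℝ) S‖
  rw [mul_div_assoc', le_div_iff₀ hD']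
  have h4 : D * I ≤ 2 * N * S.trace := by linarith
  nlinarith

lemma haarOrth_diagDev_le {D : ℕ} {S : Matrix (Fin D) (Fin D) ℝ} (hS : S.PosSemidef)
    (htr : 0 < S.trace) {δ : ℝ} (hδ : 0 < δ) :
    haarOrth D {Q | δ ≤ diagDev S Q} ≤ ENNReal.ofReal (2 / effRank S / δ) := by
  have hcont : Continuous (diagDev S) := by
    have := continuous_conj_apply S
    unfold diagDev
    fun_prop
  have hnn : ∀ Q, 0 ≤ diagDev S Q := fun Q => by unfold diagDev; positivity
  have h := mul_meas_ge_le_integral_of_nonneg (.of_forall hnn) (integrable_haarOrth hcont) δ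
  rw [← ENNReal.ofReal_toReal (measure_ne_top (haarOrth D) _)]
  refine ENNReal.ofReal_le_ofReal ?_
  rw [le_div_iff₀ hδ, mul_comm]
  exact h.trans (integral_diagDev_le hS htr)

/-- Functions that are small when the rotated diagonal is nearly constant tend to `0` in
probability as the effective rank tends to infinity. -/
lemma tendstoZeroInProb_of_diagDev {d : ℕ → ℕ} {S : ∀ k, Matrix (Fin (d k)) (Fin (d k)) ℝ}
    (hS : ∀ k, (S k).PosSemidef) (hr : Tendsto (fun k => effRank (S k)) atTop atTop)
    {X : ∀ k, Orth (d k) → ℝ}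
    (hX : ∀ ε > 0, ∃ δ > 0, ∀ k Q, 0 < (S k).trace → diagDev (S k) Q < δ → |X k Q| < ε) :
    TendstoZeroInProb X := by
  intro ε hε
  obtain ⟨δ, hδ, h⟩ := hX ε hε
  have hlim : Tendsto (fun k => ENNReal.ofReal (2 / effRank (S k) / δ)) atTop (𝓝 0) := by
    have := (ENNReal.tendsto_ofReal ((hr.const_div_atTop 2).div_const δ))
    simpa using this
  refine tendsto_of_tendsto_of_tendsto_of_le_of_le' tendsto_const_nhds hlim
    (.of_forall fun k => bot_le) ?_
  -- Positive effective rank excludes trace zero, where the quotient is `0`; this can fail only for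
  -- finitely many `k`.
  filter_upwards [hr.eventually_gt_atTop 0] with k hk
  have htr : 0 < (S k).trace := by
    rw [effRank] at hk
    refine (hS k).trace_nonneg.lt_of_ne fun h0 => ?_
    rw [← h0, zero_div] at hk
    exact hk.false
  refine (measure_mono fun Q hQ => ?_).trans (haarOrth_diagDev_le (hS k) htr hδ)
  by_contra hlt
  exact (h k Q htr (not_le.1 hlt)).not_ge hQ

lemma exists_diagDev_bound {η : ℝ} (hη : 0 < η) : ∃ δ > 0, ∀ (D : ℕ) (S : Matrix (Fin D) (Fin D) ℝ)
    (Q : Orth D), S.PosSemidef → 0 < S.trace → diagDev S Q < δ →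
    0 < mean (rotatedStd S Q) ∧ cvSq (rotatedStd S Q) < η := by
  -- For `V < 1 / 2` one has `V / (1 - V) ≤ 2 * V`, which is below `η` once `V < η / 2`.
  refine ⟨min (1 / 2) (η / 2), by positivity, fun D S Q hS htr hlt => ?_⟩
  have h1 := hlt.trans_le (min_le_left _ _)
  have h2 := hlt.trans_le (min_le_right _ _)
  obtain ⟨hm, hcv⟩ := mean_rotatedStd_pos_and_cvSq_le hS htr Q (by linarith)
  refine ⟨hm, hcv.trans_lt ?_⟩
  rw [div_lt_iff₀ (by linarith)]
  nlinarith

end BQ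

theorem mainTheorem4 :
    ∃ Δ₀ : ℝ, 0 < Δ₀ ∧
      (∀ (D : ℕ) (σ : Fin D → ℝ), 0 < BQ.mean σ → BQ.isoGain σ = Δ₀) ∧
      ∀ (d : ℕ → ℕ) (S : ∀ k, Matrix (Fin (d k)) (Fin (d k)) ℝ),
        (∀ k, (S k).PosSemidef) →
        Tendsto (fun k => BQ.effRank (S k)) atTop atTop →
        BQ.TendstoZeroInProb (fun k Q => BQ.cvSq (BQ.rotatedStd (S k) Q)) ∧
        BQ.TendstoZeroInProb (fun k Q => BQ.hetGain (BQ.rotatedStd (S k) Q)) ∧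
        BQ.TendstoZeroInProb (fun k Q => BQ.advantage (BQ.rotatedStd (S k) Q) - Δ₀) := by
  refine ⟨BQ.isoAdvantage, sub_pos.2 BQ.isoCorr_sign_lt_isoCorr_twoBit,
    fun D σ hm => BQ.isoGain_eq hm, fun d S hS hr => ?_⟩
  -- Positivity of the mean is carried along because the isotropic gain is the universal constant
  -- only there.
  have hadv : ∀ ε > 0, ∃ δ > 0, ∀ k (Q : BQ.Orth (d k)), 0 < (S k).trace →
      BQ.diagDev (S k) Q < δ → 0 < BQ.mean (BQ.rotatedStd (S k) Q) ∧
        |BQ.advantage (BQ.rotatedStd (S k) Q) - BQ.isoAdvantage| < ε := by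
    intro ε hε
    obtain ⟨η, hη, h⟩ := BQ.exists_abs_advantage_sub_lt hε
    obtain ⟨δ, hδ, h'⟩ := BQ.exists_diagDev_bound hη
    refine ⟨δ, hδ, fun k Q htr hQ => ?_⟩
    obtain ⟨hm, hcv⟩ := h' _ _ Q (hS k) htr hQ
    exact ⟨hm, h _ _ hm hcv⟩
  refine ⟨BQ.tendstoZeroInProb_of_diagDev hS hr fun ε hε => ?_,
    BQ.tendstoZeroInProb_of_diagDev hS hr fun ε hε => ?_,
    BQ.tendstoZeroInProb_of_diagDev hS hr fun ε hε => ?_⟩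
  · obtain ⟨δ, hδ, h⟩ := BQ.exists_diagDev_bound hε
    refine ⟨δ, hδ, fun k Q htr hQ => ?_⟩
    rw [abs_of_nonneg (BQ.cvSq_nonneg _)]
    exact (h _ _ Q (hS k) htr hQ).2
  · obtain ⟨δ, hδ, h⟩ := hadv ε hε
    refine ⟨δ, hδ, fun k Q htr hQ => ?_⟩
    obtain ⟨hm, hlt⟩ := h k Q htr hQ
    rwa [BQ.hetGain, BQ.isoGain_eq hm]
  · obtain ⟨δ, hδ, h⟩ := hadv ε hε
    exact ⟨δ, hδ, fun k Q htr hQ => (h k Q htr hQ).2⟩
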